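/- For an algebraic integer $\alpha\in\mathbb{C}$ let $\operatorname{ind}(\alpha):=(\mathcal{O}_M^+:\mathbb{Z}[\alpha]^+)$ denote its index, that is, the index of the additive group of $\mathbb{Z}[\alpha]$ in the additive group of the ring of integers $\mathcal{O}_M$ of the number field $M=\mathbb{Q}(\alpha)$. Let $m\neq\pm1$ be a square-free integer (so $m\ne 0$), let $n_1,n_2\geq 2$ be coprime integers and put $n=n_1n_2$. Let $\sqrt[n]{m},\sqrt[n_1]{m},\sqrt[n_2]{m}\in\mathbb{C}$ denote arbitrary (independently chosen) complex roots of $X^{n}-m$, $X^{n_1}-m$ and $X^{n_2}-m$, respectively. Then $$\operatorname{ind}\left(\sqrt[n]{m}\right)=\left(\operatorname{ind}\left(\sqrt[n_1]{m}\right)\right)^{n_2}\cdot\left(\operatorname{ind}\left(\sqrt[n_2]{m}\right)\right)^{n_1}.$$ -/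

import Mathlib

open scoped IntermediateField

/-- The index `(𝓞_M⁺ : ℤ[α]⁺)` of an algebraic integer `α`, where `M = ℚ(α)` and `𝓞_M` is the ring
of integers of `M`, i.e. the integral closure of `ℤ` in `M`.  For an algebraic integer `α`, the
subring `ℤ[α]` is contained in `𝓞_M` and the index is finite, hence positive
(see `ringIndex_pos`). -/
noncomputable def ringIndex (α : ℂ) : ℕ :=
  (Algebra.adjoin ℤ {IntermediateField.AdjoinSimple.gen ℚ α}).toSubring.toAddSubgroup.relIndex
    (integralClosure ℤ ℚ⟮α⟯).toSubring.toAddSubgroup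

/-- The integral elements of a number field have a common denominator relative to `ℤ[B.gen]`. -/
theorem exists_zsmul_mem_adjoin_gen {M : Type*} [Field M] [Algebra ℚ M] [FiniteDimensional ℚ M]
    (B : PowerBasis ℚ M) (hint : IsIntegral ℤ B.gen) :
    ∃ d : ℤ, d ≠ 0 ∧ ∀ z : M, IsIntegral ℤ z → d • z ∈ Algebra.adjoin ℤ {B.gen} := by
  have hdi : IsIntegral ℤ (Algebra.discr ℚ B.basis) := by
    refine Algebra.discr_isIntegral ℚ fun i => ?_
    rw [PowerBasis.basis_eq_pow]
    exact hint.pow _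
  obtain ⟨d, hd⟩ := IsIntegrallyClosed.isIntegral_iff.1 hdi
  refine ⟨d, ?_, fun z hz => ?_⟩
  · rintro rfl
    exact Algebra.discr_not_zero_of_basis ℚ B.basis (by rw [← hd]; simp)
  · have := Algebra.discr_mul_isIntegral_mem_adjoin ℚ hint hz
    rw [← hd] at this
    simpa [Algebra.smul_def] using this

/-- The index of an algebraic integer is a genuine (finite) index. -/
theorem ringIndex_pos {α : ℂ} (hα : IsIntegral ℤ α) : 0 < ringIndex α := by
  have hαQ : IsIntegral ℚ α := hα.tower_top
  have : FiniteDimensional ℚ ℚ⟮α⟯ := IntermediateField.adjoin.finiteDimensional hαQ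
  have : NumberField ℚ⟮α⟯ := { to_charZero := inferInstance, to_finiteDimensional := this }
  set M := ℚ⟮α⟯
  set g : M := IntermediateField.AdjoinSimple.gen ℚ α
  let B := IntermediateField.adjoin.powerBasis hαQ
  have hBg : B.gen = g := IntermediateField.adjoin.powerBasis_gen hαQ
  have hg : IsIntegral ℤ g := by
    refine (isIntegral_algebraMap_iff (B := ℂ) (algebraMap M ℂ).injective).1 ?_
    exact hα
  obtain ⟨d, hd0, hd⟩ : ∃ d : ℤ, d ≠ 0 ∧
      ∀ z : M, IsIntegral ℤ z → d • z ∈ Algebra.adjoin ℤ {g} :=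
    hBg ▸ exists_zsmul_mem_adjoin_gen B (hBg ▸ hg)
  unfold ringIndex
  set H := (Algebra.adjoin ℤ {g}).toSubring.toAddSubgroup
  set O := (integralClosure ℤ M).toSubring.toAddSubgroup
  have : Module.Finite ℤ (integralClosure ℤ M) :=
    inferInstanceAs (Module.Finite ℤ (NumberField.RingOfIntegers M))
  have : AddGroup.FG O := by
    have : AddGroup.FG (integralClosure ℤ M) := Module.Finite.iff_addGroup_fg.1 inferInstance
    exact this
  have : Finite (O ⧸ H.addSubgroupOf O) := by
    refine AddCommGroup.finite_of_fg_isAddTorsion _ fun x => ?_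
    induction x using QuotientAddGroup.induction_on with
    | H z =>
      refine isOfFinAddOrder_iff_zsmul_eq_zero.2 ⟨d, hd0, ?_⟩
      rw [← QuotientAddGroup.mk_zsmul, QuotientAddGroup.eq_zero_iff, AddSubgroup.mem_addSubgroupOf]
      exact hd z.1 z.2
  exact Nat.pos_of_ne_zero (AddSubgroup.index_ne_zero_of_finite (H := H.addSubgroupOf O))

open Polynomial

/-! Let `A = ℤ[α]`, let `O` be the integers of `ℚ(α)`, and let `R₁ = ⊕ O₁ αⁱ` for `i < n₂`, with
`O₁` the integers of `ℚ(α ^ n₂)`; define `R₂` symmetrically. Since `A = ⊕ ℤ[α ^ n₂] αⁱ`, the index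
of `A` in `R₁` is `ind(α ^ n₂) ^ n₂`. It remains to see that `R₁ ∩ R₂ = A` and `R₁ + R₂ = O`, for
then `(O : R₁) = (R₂ : A)`.

Discriminants bound the denominators. Over `ℤ` the factor `m` drops out because `X ^ n - m` is
Eisenstein at every prime dividing `m`, so `n₁ ^ n₁` kills `R₁ / A` and some `d` prime to `m` kills
`O / A`. Over `O₁` the discriminant gives that `(n₂ m) ^ n₂` kills `O / R₁`
(`exists_intermediate_addSubgroup`). Coprimality of `n₁` and `n₂` then gives both equalities. -/

theorem exists_mul_pow_coprime_dvd (m N : ℕ) (hN : N ≠ 0) :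
    ∃ d j : ℕ, d.Coprime m ∧ N ∣ d * m ^ j := by
  induction N using Nat.strong_induction_on with
  | _ N ih =>
    by_cases h : N.Coprime m
    · exact ⟨N, 0, h, by simp⟩
    -- Removing `gcd(N, m) > 1` makes `N` smaller at the cost of one factor `m`.
    · obtain ⟨N', hN'⟩ := Nat.gcd_dvd_left N m
      have hg0 : 0 < N.gcd m := Nat.gcd_pos_of_pos_left _ (Nat.pos_of_ne_zero hN)
      have hg : 1 < N.gcd m := lt_of_le_of_ne hg0 (Ne.symm h)
      have hN'0 : N' ≠ 0 := by rintro rfl; simp at hN'; exact hN hN'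
      have hlt : N' < N := by
        conv_rhs => rw [hN']
        exact (Nat.lt_mul_iff_one_lt_left (Nat.pos_of_ne_zero hN'0)).2 hg
      obtain ⟨d, j, hd, hdvd⟩ := ih N' hlt hN'0
      refine ⟨d, j + 1, hd, ?_⟩
      rw [hN', mul_comm, pow_succ, ← mul_assoc]
      exact mul_dvd_mul hdvd (Nat.gcd_dvd_right N m)

/-! ### Eisenstein primes and discriminants -/

theorem isEisensteinAt_X_pow_sub_C {m p : ℤ} (hm : Squarefree m) (hp : Prime p) (hpm : p ∣ m)
    {n : ℕ} (hn : 0 < n) : (X ^ n - C m : ℤ[X]).IsEisensteinAt (Ideal.span {p}) where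
  leading := by
    rw [(monic_X_pow_sub_C m hn.ne').leadingCoeff, Ideal.mem_span_singleton]
    exact fun h => hp.not_isUnit (isUnit_of_dvd_one h)
  mem {i} hi := by
    rw [natDegree_X_pow_sub_C] at hi
    rw [Ideal.mem_span_singleton, coeff_sub, coeff_X_pow, if_neg hi.ne, coeff_C, zero_sub, dvd_neg]
    split_ifs <;> simp [hpm]
  notMem := by
    rw [Ideal.span_singleton_pow, Ideal.mem_span_singleton, coeff_sub, coeff_X_pow,
      if_neg hn.ne, coeff_C_zero, zero_sub, dvd_neg, sq]
    exact fun h => hp.not_isUnit (hm p h)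

theorem irreducible_X_pow_sub_C_of_squarefree {m : ℤ} (hm : Squarefree m) (hu : ¬IsUnit m)
    {n : ℕ} (hn : 0 < n) : Irreducible (X ^ n - C m : ℤ[X]) := by
  obtain ⟨p, hp, hpm⟩ := WfDvdMonoid.exists_irreducible_factor hu hm.ne_zero
  have hp' : Prime p := hp.prime
  exact (isEisensteinAt_X_pow_sub_C hm hp' hpm hn).irreducible
    ((Ideal.span_singleton_prime hp'.ne_zero).2 hp') (monic_X_pow_sub_C m hn.ne').isPrimitive
    (by rwa [natDegree_X_pow_sub_C])

section Roots

variable {M : Type*} [Field M] [Algebra ℚ M] {m : ℤ} {n : ℕ} {g : M}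

theorem minpoly_rat_of_pow_eq (hm : Squarefree m) (hu : ¬IsUnit m) (hn : 0 < n)
    (hg : g ^ n = (m : M)) : minpoly ℚ g = X ^ n - C (m : ℚ) := by
  have hirr := ((monic_X_pow_sub_C m hn.ne').irreducible_iff_irreducible_map_fraction_map
    (K := ℚ)).1 (irreducible_X_pow_sub_C_of_squarefree hm hu hn)
  have hmap : (X ^ n - C m : ℤ[X]).map (algebraMap ℤ ℚ) = X ^ n - C (m : ℚ) := by simp
  rw [hmap] at hirr
  refine (minpoly.eq_of_irreducible_of_monic hirr ?_ (monic_X_pow_sub_C _ hn.ne')).symm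
  simp [hg]

omit [Algebra ℚ M] in
theorem isIntegral_of_pow_eq_intCast {R : Type*} [CommRing R] [Algebra R M] (hn : 0 < n)
    (hg : g ^ n = (m : M)) : IsIntegral R g := by
  refine IsIntegral.of_pow hn ?_
  rw [hg, ← map_intCast (algebraMap R M)]
  exact isIntegral_algebraMap

theorem minpoly_int_of_pow_eq (hm : Squarefree m) (hu : ¬IsUnit m) (hn : 0 < n)
    (hg : g ^ n = (m : M)) : minpoly ℤ g = X ^ n - C m := by
  have : CharZero M := algebraRat.charZero M
  apply map_injective (algebraMap ℤ ℚ) (algebraMap ℤ ℚ).injective_int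
  rw [← minpoly.isIntegrallyClosed_eq_field_fractions' ℚ (isIntegral_of_pow_eq_intCast hn hg),
    minpoly_rat_of_pow_eq hm hu hn hg]
  simp

/-- The primes of `k` divide `m`, so the minimal polynomial is Eisenstein at each and they can be
cancelled one at a time. -/
theorem mem_adjoin_of_zsmul_mem_of_pow_eq (hm : Squarefree m) (hu : ¬IsUnit m) (hn : 0 < n)
    (B : PowerBasis ℚ M) (hg : B.gen ^ n = (m : M)) {k : ℤ} (hk : k ∣ m) {z : M}
    (hz : IsIntegral ℤ z) (hkz : k • z ∈ Algebra.adjoin ℤ {B.gen}) :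
    z ∈ Algebra.adjoin ℤ {B.gen} := by
  induction k using UniqueFactorizationMonoid.induction_on_prime generalizing z with
  | h₁ => exact absurd (zero_dvd_iff.1 hk) hm.ne_zero
  | h₂ u hunit =>
    obtain ⟨v, hv⟩ := hunit.exists_left_inv
    have := Subalgebra.smul_mem _ hkz v
    rwa [smul_smul, hv, one_smul] at this
  | h₃ a p ha hp ih =>
    refine ih (dvd_of_mul_left_dvd hk) hz ?_
    refine mem_adjoin_of_smul_prime_smul_of_minpoly_isEisensteinAt (K := ℚ) hp
      (isIntegral_of_pow_eq_intCast hn hg) (hz.smul a) (by rwa [smul_smul]) ?_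
    rw [minpoly_int_of_pow_eq hm hu hn hg]
    exact isEisensteinAt_X_pow_sub_C hm hp (dvd_of_mul_right_dvd hk) hn

theorem mem_adjoin_of_pow_zsmul_mem_of_pow_eq (hm : Squarefree m) (hu : ¬IsUnit m) (hn : 0 < n)
    (B : PowerBasis ℚ M) (hg : B.gen ^ n = (m : M)) (j : ℕ) {z : M}
    (hz : IsIntegral ℤ z) (hkz : m ^ j • z ∈ Algebra.adjoin ℤ {B.gen}) :
    z ∈ Algebra.adjoin ℤ {B.gen} := by
  induction j with
  | zero => simpa using hkz
  | succ j ih =>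
    rw [pow_succ', mul_smul] at hkz
    exact ih (mem_adjoin_of_zsmul_mem_of_pow_eq hm hu hn B hg dvd_rfl (hz.smul _) hkz)

end Roots

/-- With `f = X ^ k - b` and `g` the generator, `f'(g) g = k b`. Taking norms shows that `(k b) ^ k`
is `± b` times the discriminant, which clears denominators. A general base `R` is needed for the
relative extension `ℚ(α)` over `ℚ(α ^ b)`. -/
theorem mul_pow_smul_mem_adjoin_of_pow_eq {R K L : Type*} [CommRing R] [Field K] [Field L]
    [CharZero K]
    [Algebra R K] [Algebra R L] [Algebra K L] [IsScalarTower R K L] [IsIntegrallyClosed R]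
    [IsFractionRing R K] (B : PowerBasis K L) {k : ℕ} (hk : 0 < k) (b : R)
    (hB : minpoly K B.gen = X ^ k - C (algebraMap R K b)) {z : L} (hz : IsIntegral R z) :
    (k * b) ^ k • z ∈ Algebra.adjoin R {B.gen} := by
  have : FiniteDimensional K L := B.finite
  have : IsDomain R := (IsFractionRing.injective R K).isDomain
  have hdim : B.dim = k := by rw [← B.natDegree_minpoly, hB, natDegree_X_pow_sub_C]
  have hgen : B.gen ^ k = algebraMap R L b := by
    have := minpoly.aeval K B.gen
    rw [hB] at this
    simpa [sub_eq_zero, ← IsScalarTower.algebraMap_apply] using this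
  have hint : IsIntegral R B.gen := IsIntegral.of_pow hk (hgen ▸ isIntegral_algebraMap)
  have hnorm : Algebra.norm K B.gen = (-1) ^ (k + 1) * algebraMap R K b := by
    rw [Algebra.PowerBasis.norm_gen_eq_coeff_zero_minpoly, hB, hdim, coeff_sub, coeff_X_pow,
      if_neg hk.ne, coeff_C_zero]
    ring
  have hdiscr : (-1) ^ (k * (k - 1) / 2) * (-1) ^ (k + 1) * algebraMap R K b *
      Algebra.discr K B.basis = algebraMap R K ((k * b) ^ k) := by
    have hder : aeval B.gen (derivative (minpoly K B.gen)) * B.gen =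
        algebraMap K L (algebraMap R K (k * b)) := by
      rw [hB, ← IsScalarTower.algebraMap_apply]
      simp only [derivative_sub, derivative_X_pow, derivative_C, sub_zero, map_mul, map_pow, aeval_X,
        map_natCast]
      rw [mul_assoc, ← pow_succ, Nat.sub_add_cancel hk, hgen]
    have hn := congrArg (Algebra.norm K) hder
    rw [map_mul, hnorm, Algebra.norm_algebraMap, B.finrank, hdim] at hn
    rw [Algebra.discr_powerBasis_eq_norm, B.finrank, hdim, map_pow, ← hn]
    have h1 : ((-1 : K) ^ (k * (k - 1) / 2)) * (-1) ^ (k * (k - 1) / 2) = 1 := by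
      rw [← mul_pow]; simp
    linear_combination ((-1) ^ (k + 1) * algebraMap R K b *
      Algebra.norm K (aeval B.gen (derivative (minpoly K B.gen)))) * h1
  have key := Algebra.discr_mul_isIntegral_mem_adjoin K hint hz
  have := Subalgebra.smul_mem _ key ((-1) ^ (k * (k - 1) / 2) * (-1) ^ (k + 1) * b)
  convert this using 1
  rw [← algebraMap_smul K, ← hdiscr, ← algebraMap_smul K (_ * _ : R), smul_smul]
  simp

/-! ### Expansions in powers of `α` and their indices -/

theorem mem_adjoin_singleton_iff_of_pow_eq {R B : Type*} [CommRing R] [Nontrivial R] [CommRing B]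
    [Algebra R B]
    {α : B} {b : R} {k : ℕ} (hk : 0 < k) (hα : α ^ k = algebraMap R B b) {z : B} :
    z ∈ Algebra.adjoin R {α} ↔ ∃ c : Fin k → R, z = ∑ i : Fin k, c i • α ^ (i : ℕ) := by
  constructor
  · intro hz
    rw [Algebra.adjoin_singleton_eq_range_aeval] at hz
    obtain ⟨p, rfl⟩ := hz
    have hmon : (X ^ k - C b).Monic := monic_X_pow_sub_C b hk.ne'
    have h0 : aeval α (X ^ k - C b) = 0 := by simp [hα]
    have hdeg : (p %ₘ (X ^ k - C b)).natDegree < k := by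
      have := natDegree_modByMonic_lt p hmon (by
        intro h
        have := congrArg natDegree h
        rw [natDegree_X_pow_sub_C, natDegree_one] at this
        exact hk.ne' this)
      rwa [natDegree_X_pow_sub_C] at this
    refine ⟨fun i => (p %ₘ (X ^ k - C b)).coeff i, ?_⟩
    rw [Fin.sum_univ_eq_sum_range (fun i => (p %ₘ (X ^ k - C b)).coeff i • α ^ i) k,
      ← aeval_eq_sum_range' hdeg]
    conv_lhs => rw [← modByMonic_add_div p (X ^ k - C b)]
    simp [h0]
  · rintro ⟨c, rfl⟩
    exact Subalgebra.sum_mem _ fun i _ => Subalgebra.smul_mem _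
      (Subalgebra.pow_mem _ (Algebra.self_mem_adjoin_singleton R α) _) _

theorem AddSubgroup.relIndex_pi_univ {ι G : Type*} [Fintype ι] [AddCommGroup G]
    (S T : AddSubgroup G) :
    (AddSubgroup.pi Set.univ fun _ : ι => S).relIndex (AddSubgroup.pi Set.univ fun _ : ι => T) =
      S.relIndex T ^ Fintype.card ι := by
  let f : (ι → T) →+ (ι → G) := T.subtype.compLeft ι
  have hr : f.range = AddSubgroup.pi Set.univ fun _ : ι => T := by
    ext x
    simp only [AddMonoidHom.mem_range, AddSubgroup.mem_pi, Set.mem_univ, true_imp_iff]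
    constructor
    · rintro ⟨y, rfl⟩ i
      exact (y i).2
    · exact fun h => ⟨fun i => ⟨x i, h i⟩, rfl⟩
  have hc : (AddSubgroup.pi Set.univ fun _ : ι => S).comap f =
      AddSubgroup.pi Set.univ fun _ : ι => S.addSubgroupOf T := by
    ext x
    simp [AddSubgroup.mem_pi, AddSubgroup.mem_addSubgroupOf, f]
  rw [← hr, ← AddSubgroup.index_comap, hc, AddSubgroup.index_pi]
  simp [AddSubgroup.relIndex]

/-- The additive group of the sums `∑ i < k, c i • α ^ i` with coefficients in `S`. -/
noncomputable def powSpan {K L : Type*} [Field K] [Field L] [Algebra K L] (α : L) (k : ℕ)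
    (S : AddSubgroup K) : AddSubgroup L :=
  (AddSubgroup.pi Set.univ fun _ : Fin k => S).map
    (Fintype.linearCombination K fun i : Fin k => α ^ (i : ℕ)).toAddMonoidHom

section powSpan

variable {K L : Type*} [Field K] [Field L] [Algebra K L] {α : L} {k : ℕ} {S T : AddSubgroup K}

theorem mem_powSpan {z : L} :
    z ∈ powSpan α k S ↔ ∃ c : Fin k → K, (∀ i, c i ∈ S) ∧ z = ∑ i, c i • α ^ (i : ℕ) := by
  simp [powSpan, AddSubgroup.mem_map, AddSubgroup.mem_pi, Fintype.linearCombination_apply, eq_comm]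

theorem powSpan_mono (h : S ≤ T) : powSpan α k S ≤ powSpan α k T := by
  intro z
  simp only [mem_powSpan]
  exact fun ⟨c, hc, hz⟩ => ⟨c, fun i => h (hc i), hz⟩

theorem zsmul_mem_powSpan {d : ℤ} (h : ∀ x ∈ T, d • x ∈ S) {z : L} (hz : z ∈ powSpan α k T) :
    d • z ∈ powSpan α k S := by
  rw [mem_powSpan] at hz ⊢
  obtain ⟨c, hc, rfl⟩ := hz
  exact ⟨fun i => d • c i, fun i => h _ (hc i), by simp only [Finset.smul_sum, smul_assoc]⟩

/-- Powers of `α` below the degree are independent, so this is the index of a `k`-fold product. -/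
theorem relIndex_powSpan (h : (minpoly K α).natDegree = k) :
    (powSpan α k S).relIndex (powSpan α k T) = S.relIndex T ^ k := by
  subst h
  have hli := linearIndependent_pow (K := K) α
  rw [powSpan, powSpan, AddSubgroup.relIndex_map_map_of_injective, AddSubgroup.relIndex_pi_univ,
    Fintype.card_fin]
  exact hli.fintypeLinearCombination_injective

end powSpan

/-! ### Denominators for roots of `m` -/

section Roots

variable {M : Type*} [Field M] [Algebra ℚ M] {m : ℤ} {n : ℕ}

theorem pow_smul_mem_adjoin_of_pow_eq (hm : Squarefree m) (hu : ¬IsUnit m) (hn : 0 < n)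
    (B : PowerBasis ℚ M) (hg : B.gen ^ n = (m : M)) {z : M} (hz : IsIntegral ℤ z) :
    (n : ℤ) ^ n • z ∈ Algebra.adjoin ℤ {B.gen} := by
  refine mem_adjoin_of_pow_zsmul_mem_of_pow_eq hm hu hn B hg n (hz.smul _) ?_
  rw [smul_smul, ← mul_pow, mul_comm]
  refine mul_pow_smul_mem_adjoin_of_pow_eq B hn m ?_ hz
  simpa using minpoly_rat_of_pow_eq hm hu hn hg

theorem exists_coprime_smul_mem_adjoin_of_pow_eq (hm : Squarefree m) (hu : ¬IsUnit m) (hn : 0 < n)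
    (B : PowerBasis ℚ M) (hg : B.gen ^ n = (m : M)) :
    ∃ d : ℤ, IsCoprime d m ∧ ∀ z : M, IsIntegral ℤ z → d • z ∈ Algebra.adjoin ℤ {B.gen} := by
  obtain ⟨d, j, hd, hdvd⟩ := exists_mul_pow_coprime_dvd m.natAbs (n ^ n) (pow_ne_zero _ hn.ne')
  refine ⟨d, Int.isCoprime_iff_nat_coprime.2 (by simpa using hd), fun z hz => ?_⟩
  refine mem_adjoin_of_pow_zsmul_mem_of_pow_eq hm hu hn B hg j (hz.smul _) ?_
  -- `d` carries the part of `n ^ n` prime to `m`; the remaining `m ^ j` is cancelled by Eisenstein.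
  have h : (n : ℤ) ^ n ∣ m ^ j * d := by
    rw [← Int.natAbs_dvd_natAbs]
    simpa [Int.natAbs_mul, Int.natAbs_pow, mul_comm] using hdvd
  obtain ⟨c, hc⟩ := h
  rw [smul_smul, hc, mul_comm, mul_smul]
  exact Subalgebra.smul_mem _ (pow_smul_mem_adjoin_of_pow_eq hm hu hn B hg hz) c

end Roots

/-! ### Conjugate roots and subgroups of `ℂ` -/

theorem ringIndex_eq_of_minpoly_eq {α β : ℂ} (hα : IsAlgebraic ℚ α)
    (h : minpoly ℚ α = minpoly ℚ β) : ringIndex α = ringIndex β := by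
  let e := minpoly.algEquiv hα h
  have he : e (IntermediateField.AdjoinSimple.gen ℚ α) = IntermediateField.AdjoinSimple.gen ℚ β :=
    minpoly.algEquiv_apply hα h
  let f : ℚ⟮α⟯ →ₐ[ℤ] ℚ⟮β⟯ := e.toAlgHom.restrictScalars ℤ
  have hf : Function.Injective f := e.injective
  rw [ringIndex, ← AddSubgroup.relIndex_map_map_of_injective (f := (f : ℚ⟮α⟯ →+ ℚ⟮β⟯)) _ _ hf,
    ringIndex]
  congr 1
  · have := AlgHom.map_adjoin_singleton f (IntermediateField.AdjoinSimple.gen ℚ α)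
    rw [show f (IntermediateField.AdjoinSimple.gen ℚ α) = _ from he] at this
    rw [← this]
    rfl
  · ext z
    constructor
    · rintro ⟨x, hx, rfl⟩
      exact IsIntegral.map f hx
    · intro hz
      exact ⟨e.symm z, IsIntegral.map (e.symm.toAlgHom.restrictScalars ℤ) hz, e.apply_symm_apply z⟩

/-- All roots are conjugate, which allows `α ^ n₂` and `α ^ n₁` to stand for the given roots. -/
theorem ringIndex_eq_of_pow_eq {m : ℤ} (hm : Squarefree m) (hu : ¬IsUnit m) {n : ℕ} (hn : 0 < n)
    {α β : ℂ} (hα : α ^ n = m) (hβ : β ^ n = m) : ringIndex α = ringIndex β :=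
  ringIndex_eq_of_minpoly_eq (isIntegral_of_pow_eq_intCast hn hα).isAlgebraic <| by
    rw [minpoly_rat_of_pow_eq hm hu hn hα, minpoly_rat_of_pow_eq hm hu hn hβ]

/-- The additive group of the integers of `ℚ(α)`, inside `ℂ`. -/
noncomputable def integersOfAdjoin (α : ℂ) : AddSubgroup ℂ :=
  (integralClosure ℤ ℂ).toSubring.toAddSubgroup ⊓ ℚ⟮α⟯.toSubfield.toSubring.toAddSubgroup

/-- The additive group of `ℤ[α]`, inside `ℂ`. -/
noncomputable def adjoinInt (α : ℂ) : AddSubgroup ℂ :=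
  (Algebra.adjoin ℤ {α}).toSubring.toAddSubgroup

theorem mem_integersOfAdjoin {α z : ℂ} : z ∈ integersOfAdjoin α ↔ IsIntegral ℤ z ∧ z ∈ ℚ⟮α⟯ :=
  Iff.rfl

theorem mem_adjoinInt {α z : ℂ} : z ∈ adjoinInt α ↔ z ∈ Algebra.adjoin ℤ {α} :=
  Iff.rfl

theorem coe_mem_adjoinInt_iff {α : ℂ} {z : ℚ⟮α⟯} :
    (z : ℂ) ∈ adjoinInt α ↔
      z ∈ Algebra.adjoin ℤ {IntermediateField.AdjoinSimple.gen ℚ α} := by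
  have := AlgHom.map_adjoin_singleton (ℚ⟮α⟯.val.restrictScalars ℤ)
    (IntermediateField.AdjoinSimple.gen ℚ α)
  rw [show (ℚ⟮α⟯.val.restrictScalars ℤ) (IntermediateField.AdjoinSimple.gen ℚ α) = α from rfl]
    at this
  rw [mem_adjoinInt, ← this, Subalgebra.mem_map]
  constructor
  · rintro ⟨x, hx, hxz⟩
    rwa [← Subtype.ext (a1 := x) (a2 := z) hxz]
  · exact fun h => ⟨z, h, rfl⟩

theorem isIntegral_coe_iff {α : ℂ} {z : ℚ⟮α⟯} : IsIntegral ℤ (z : ℂ) ↔ IsIntegral ℤ z :=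
  isIntegral_algebraMap_iff (B := ℂ) (algebraMap ℚ⟮α⟯ ℂ).injective

theorem relIndex_adjoinInt_integersOfAdjoin (α : ℂ) :
    (adjoinInt α).relIndex (integersOfAdjoin α) = ringIndex α := by
  rw [ringIndex, ← AddSubgroup.relIndex_map_map_of_injective
    (f := (ℚ⟮α⟯.val : ℚ⟮α⟯ →+ ℂ)) _ _ Subtype.val_injective]
  congr 1
  · have := AlgHom.map_adjoin_singleton (ℚ⟮α⟯.val.restrictScalars ℤ)
      (IntermediateField.AdjoinSimple.gen ℚ α)
    rw [show (ℚ⟮α⟯.val.restrictScalars ℤ) (IntermediateField.AdjoinSimple.gen ℚ α) = α from rfl]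
      at this
    rw [adjoinInt, ← this]
    rfl
  · ext z
    rw [mem_integersOfAdjoin]
    constructor
    · exact fun ⟨h1, h2⟩ => ⟨⟨z, h2⟩, isIntegral_coe_iff.1 h1, rfl⟩
    · rintro ⟨x, hx, rfl⟩
      exact ⟨isIntegral_coe_iff.2 hx, x.2⟩

theorem exists_coprime_smul_mem_adjoinInt {m : ℤ} (hm : Squarefree m) (hu : ¬IsUnit m) {n : ℕ}
    (hn : 0 < n) {α : ℂ} (hα : α ^ n = m) :
    ∃ d : ℤ, IsCoprime d m ∧ ∀ z ∈ integersOfAdjoin α, d • z ∈ adjoinInt α := by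
  have hαQ : IsIntegral ℚ α := isIntegral_of_pow_eq_intCast hn hα
  let B := IntermediateField.adjoin.powerBasis hαQ
  have hBg : B.gen = IntermediateField.AdjoinSimple.gen ℚ α :=
    IntermediateField.adjoin.powerBasis_gen hαQ
  obtain ⟨d, hd, h⟩ := exists_coprime_smul_mem_adjoin_of_pow_eq hm hu hn B
    (by rw [hBg]; exact Subtype.ext (by simpa using hα))
  refine ⟨d, hd, fun z hz => ?_⟩
  have := h ⟨z, hz.2⟩ (isIntegral_coe_iff.1 hz.1)
  rw [hBg, ← coe_mem_adjoinInt_iff] at this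
  simpa using this

/-! ### The tower `ℚ ⊆ ℚ(α ^ b) ⊆ ℚ(α)` -/

section Tower

variable {m : ℤ} {a b : ℕ} {α : ℂ}

theorem gen_pow_of_pow_mul (hα : α ^ (a * b) = m) :
    (IntermediateField.AdjoinSimple.gen ℚ (α ^ b)) ^ a = (m : ℚ⟮α ^ b⟯) :=
  Subtype.ext <| by simpa [← pow_mul, mul_comm b a] using hα

/-- The relative degree is at most `b`, and it cannot be smaller because the absolute degrees are `a
* b` and `a`. -/
theorem minpoly_adjoin_pow (hm : Squarefree m) (hu : ¬IsUnit m) (ha : 0 < a) (hb : 0 < b)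
    (hα : α ^ (a * b) = m) : minpoly ℚ⟮α ^ b⟯ α =
      X ^ b - C (IntermediateField.AdjoinSimple.gen ℚ (α ^ b)) := by
  have hab := Nat.mul_pos ha hb
  have hβ : (α ^ b) ^ a = m := by rw [← pow_mul, mul_comm, hα]
  have hαQ : IsIntegral ℚ α := isIntegral_of_pow_eq_intCast hab hα
  have hβQ : IsIntegral ℚ (α ^ b) := hαQ.pow b
  have hαK : IsIntegral ℚ⟮α ^ b⟯ α := hαQ.tower_top
  have hdvd : minpoly ℚ⟮α ^ b⟯ α ∣ X ^ b - C (IntermediateField.AdjoinSimple.gen ℚ (α ^ b)) := by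
    apply minpoly.dvd
    simp
  have hle : ℚ⟮α⟯ ≤ ℚ⟮α ^ b⟯⟮α⟯.restrictScalars ℚ :=
    IntermediateField.adjoin_simple_le_iff.2 (IntermediateField.mem_adjoin_simple_self _ α)
  have hf1 : FiniteDimensional ℚ ℚ⟮α ^ b⟯ := IntermediateField.adjoin.finiteDimensional hβQ
  have hf2 : FiniteDimensional ℚ⟮α ^ b⟯ ℚ⟮α ^ b⟯⟮α⟯ :=
    IntermediateField.adjoin.finiteDimensional hαK
  have hf3 : FiniteDimensional ℚ (ℚ⟮α ^ b⟯⟮α⟯.restrictScalars ℚ) :=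
    Module.Finite.trans (R := ℚ) ℚ⟮α ^ b⟯ ℚ⟮α ^ b⟯⟮α⟯
  have hrank : Module.finrank ℚ ℚ⟮α⟯ ≤ Module.finrank ℚ (ℚ⟮α ^ b⟯⟮α⟯.restrictScalars ℚ) :=
    LinearMap.finrank_le_finrank_of_injective
      (f := (IntermediateField.inclusion hle).toLinearMap)
      (IntermediateField.inclusion hle).injective
  have htower : Module.finrank ℚ ℚ⟮α ^ b⟯ * Module.finrank ℚ⟮α ^ b⟯ ℚ⟮α ^ b⟯⟮α⟯ =
      Module.finrank ℚ (ℚ⟮α ^ b⟯⟮α⟯.restrictScalars ℚ) :=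
    Module.finrank_mul_finrank ℚ ℚ⟮α ^ b⟯ ℚ⟮α ^ b⟯⟮α⟯
  rw [← htower, IntermediateField.adjoin.finrank hαQ, IntermediateField.adjoin.finrank hβQ,
    IntermediateField.adjoin.finrank hαK, minpoly_rat_of_pow_eq hm hu hab hα,
    minpoly_rat_of_pow_eq hm hu ha hβ, natDegree_X_pow_sub_C, natDegree_X_pow_sub_C] at hrank
  refine (eq_of_monic_of_dvd_of_natDegree_le (minpoly.monic hαK)
    (monic_X_pow_sub_C _ hb.ne') hdvd ?_).symm
  rw [natDegree_X_pow_sub_C]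
  exact Nat.le_of_mul_le_mul_left hrank ha

theorem powSpan_adjoin_gen (hb : 0 < b) :
    powSpan α b (Algebra.adjoin ℤ
      {IntermediateField.AdjoinSimple.gen ℚ (α ^ b)}).toSubring.toAddSubgroup = adjoinInt α := by
  set S := Algebra.adjoin ℤ {IntermediateField.AdjoinSimple.gen ℚ (α ^ b)}
  have hS : ∀ x : S, algebraMap S ℂ x ∈ adjoinInt α := fun x =>
    Algebra.adjoin_le (Set.singleton_subset_iff.2 (Subalgebra.pow_mem _
      (Algebra.self_mem_adjoin_singleton ℤ α) b)) (coe_mem_adjoinInt_iff.2 x.2)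
  let g : S := ⟨_, Algebra.self_mem_adjoin_singleton ℤ _⟩
  have hg : α ^ b = algebraMap S ℂ g := rfl
  ext z
  have h1 : z ∈ adjoinInt α ↔ z ∈ Algebra.adjoin S {α} := by
    constructor
    · intro hz
      have : Algebra.adjoin ℤ {α} ≤ (Algebra.adjoin S {α}).restrictScalars ℤ :=
        Algebra.adjoin_le (Set.singleton_subset_iff.2 (Algebra.self_mem_adjoin_singleton S α))
      exact this hz
    · intro hz
      obtain ⟨c, rfl⟩ := (mem_adjoin_singleton_iff_of_pow_eq hb hg).1 hz
      refine Subalgebra.sum_mem _ fun i _ => ?_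
      rw [Algebra.smul_def]
      exact Subalgebra.mul_mem _ (hS _)
        (Subalgebra.pow_mem _ (Algebra.self_mem_adjoin_singleton ℤ α) _)
  rw [h1, mem_adjoin_singleton_iff_of_pow_eq hb hg, mem_powSpan]
  exact ⟨fun ⟨c, hc, hz⟩ => ⟨fun i => ⟨c i, hc i⟩, hz⟩, fun ⟨c, hz⟩ =>
    ⟨fun i => c i, fun i => (c i).2, hz⟩⟩

theorem powSpan_integralClosure_le (hα : IsIntegral ℤ α) :
    powSpan α b (integralClosure ℤ ℚ⟮α ^ b⟯).toSubring.toAddSubgroup ≤ integersOfAdjoin α := by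
  intro z hz
  obtain ⟨c, hc, rfl⟩ := mem_powSpan.1 hz
  have hle : ℚ⟮α ^ b⟯ ≤ ℚ⟮α⟯ := IntermediateField.adjoin_simple_le_iff.2
    (pow_mem (IntermediateField.mem_adjoin_simple_self ℚ α) b)
  refine AddSubgroup.sum_mem _ fun i _ => ?_
  rw [Algebra.smul_def]
  exact ⟨(isIntegral_coe_iff.2 (hc i)).mul (hα.pow _),
    ℚ⟮α⟯.mul_mem (hle (c i).2) (pow_mem (IntermediateField.mem_adjoin_simple_self ℚ α) _)⟩

theorem smul_mem_powSpan_integralClosure (hm : Squarefree m) (hu : ¬IsUnit m) (ha : 0 < a)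
    (hb : 0 < b) (hα : α ^ (a * b) = m) {z : ℂ} (hz : z ∈ integersOfAdjoin α) :
    (b * m) ^ b • z ∈
      powSpan α b (integralClosure ℤ ℚ⟮α ^ b⟯).toSubring.toAddSubgroup := by
  set K := ℚ⟮α ^ b⟯
  set R := integralClosure ℤ K
  have hab := Nat.mul_pos ha hb
  have hαQ : IsIntegral ℚ α := isIntegral_of_pow_eq_intCast hab hα
  have hαZ : IsIntegral ℤ α := isIntegral_of_pow_eq_intCast hab hα
  have hαK : IsIntegral K α := hαQ.tower_top
  have hf1 : FiniteDimensional ℚ K := IntermediateField.adjoin.finiteDimensional (hαQ.pow b)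
  have : IsFractionRing R K := integralClosure.isFractionRing_of_finite_extension ℚ K
  have : IsIntegrallyClosed R := integralClosure.isIntegrallyClosedOfFiniteExtension ℚ
  let B := IntermediateField.adjoin.powerBasis hαK
  have hBg : (B.gen : ℂ) = α := by
    rw [IntermediateField.adjoin.powerBasis_gen hαK]; rfl
  let g : R := ⟨IntermediateField.AdjoinSimple.gen ℚ (α ^ b), isIntegral_coe_iff.1 (hαZ.pow b)⟩
  have hga : g ^ a = (m : R) := Subtype.ext <| by
    simpa using gen_pow_of_pow_mul hα
  have hmin : minpoly K B.gen = X ^ b - C (algebraMap R K g) := by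
    rw [← minpoly.algebraMap_eq (algebraMap K⟮α⟯ ℂ).injective B.gen]
    exact (congrArg (minpoly K) hBg).trans (minpoly_adjoin_pow hm hu ha hb hα)
  have hle : ℚ⟮α⟯ ≤ K⟮α⟯.restrictScalars ℚ :=
    IntermediateField.adjoin_simple_le_iff.2 (IntermediateField.mem_adjoin_simple_self _ α)
  let w : K⟮α⟯ := ⟨z, hle hz.2⟩
  have hw : IsIntegral ℤ w :=
    (isIntegral_algebraMap_iff (B := ℂ) (algebraMap K⟮α⟯ ℂ).injective).1 hz.1
  -- The discriminant bound gives `(b g) ^ b`; the extra factor `(g ^ (a - 1)) ^ b` turns `g` into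
  -- `g ^ a = m`.
  have key := Subalgebra.smul_mem _ (mul_pow_smul_mem_adjoin_of_pow_eq B hb g hmin
    (hw.tower_top (A := R))) ((g ^ (a - 1)) ^ b)
  have hBb : B.gen ^ b = algebraMap R K⟮α⟯ g := by
    apply Subtype.ext
    rw [SubmonoidClass.coe_pow, hBg]
    rfl
  rw [smul_smul, ← mul_pow, mul_left_comm, ← pow_succ, Nat.sub_add_cancel ha, hga,
    mem_adjoin_singleton_iff_of_pow_eq hb hBb] at key
  obtain ⟨c, hc⟩ := key
  refine mem_powSpan.2 ⟨fun i => c i, fun i => (c i).2, ?_⟩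
  have := congrArg (algebraMap K⟮α⟯ ℂ) hc
  rw [map_sum] at this
  convert this using 1
  · rw [zsmul_eq_mul, Algebra.smul_def (A := K⟮α⟯), map_mul]
    congr 1
    simp
  · refine Finset.sum_congr rfl fun i _ => ?_
    rw [Algebra.smul_def, Algebra.smul_def, map_mul, map_pow]
    exact congrArg₂ _ rfl (congrArg (· ^ (i : ℕ)) hBg.symm)

theorem exists_intermediate_addSubgroup (hm : Squarefree m) (hu : ¬IsUnit m) (ha : 0 < a)
    (hb : 0 < b) (hα : α ^ (a * b) = m) :
    ∃ R : AddSubgroup ℂ, adjoinInt α ≤ R ∧ R ≤ integersOfAdjoin α ∧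
      (adjoinInt α).relIndex R = ringIndex (α ^ b) ^ b ∧
      (∀ r ∈ R, (a : ℤ) ^ a • r ∈ adjoinInt α) ∧
      ∀ z ∈ integersOfAdjoin α, (b * m) ^ b • z ∈ R := by
  have hab := Nat.mul_pos ha hb
  have hαZ : IsIntegral ℤ α := isIntegral_of_pow_eq_intCast hab hα
  have hβQ : IsIntegral ℚ (α ^ b) := (isIntegral_of_pow_eq_intCast hab hα).pow b
  let B := IntermediateField.adjoin.powerBasis hβQ
  have hBg : B.gen = IntermediateField.AdjoinSimple.gen ℚ (α ^ b) :=
    IntermediateField.adjoin.powerBasis_gen hβQ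
  refine ⟨powSpan α b (integralClosure ℤ ℚ⟮α ^ b⟯).toSubring.toAddSubgroup, ?_,
    powSpan_integralClosure_le hαZ, ?_, fun r hr => ?_,
    fun z hz => smul_mem_powSpan_integralClosure hm hu ha hb hα hz⟩
  · rw [← powSpan_adjoin_gen hb]
    refine powSpan_mono (Algebra.adjoin_le (S := integralClosure ℤ ℚ⟮α ^ b⟯)
      (Set.singleton_subset_iff.2 ?_))
    exact isIntegral_coe_iff.1 (hαZ.pow b)
  · rw [← powSpan_adjoin_gen hb, relIndex_powSpan, ringIndex]
    rw [minpoly_adjoin_pow hm hu ha hb hα, natDegree_X_pow_sub_C]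
  · rw [← powSpan_adjoin_gen hb]
    refine zsmul_mem_powSpan (fun x hx => ?_) hr
    have := pow_smul_mem_adjoin_of_pow_eq hm hu ha B (by rw [hBg]; exact gen_pow_of_pow_mul hα) hx
    rwa [hBg] at this

end Tower

/-! ### Coprime multipliers and the index count -/

theorem AddSubgroup.mem_of_isCoprime_zsmul_mem {G : Type*} [AddCommGroup G] {H : AddSubgroup G}
    {k l : ℤ} (h : IsCoprime k l) {z : G} (hk : k • z ∈ H) (hl : l • z ∈ H) : z ∈ H := by
  obtain ⟨u, v, huv⟩ := h
  have := H.add_mem (H.zsmul_mem hk u) (H.zsmul_mem hl v)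
  rwa [smul_smul, smul_smul, ← add_smul, huv, one_smul] at this

theorem mainTheorem7 (m : ℤ) (hm : Squarefree m) (hm1 : m ≠ 1) (hm2 : m ≠ -1)
    (n n₁ n₂ : ℕ) (hn₁ : 2 ≤ n₁) (hn₂ : 2 ≤ n₂) (hcop : Nat.Coprime n₁ n₂) (hn : n = n₁ * n₂)
    (α α₁ α₂ : ℂ) (hα : α ^ n = (m : ℂ)) (hα₁ : α₁ ^ n₁ = (m : ℂ)) (hα₂ : α₂ ^ n₂ = (m : ℂ)) :
    ringIndex α = ringIndex α₁ ^ n₂ * ringIndex α₂ ^ n₁ := by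
  subst hn
  have hu : ¬IsUnit m := fun h => (Int.isUnit_iff.1 h).elim hm1 hm2
  have h1 : 0 < n₁ := by omega
  have h2 : 0 < n₂ := by omega
  have hα' : α ^ (n₂ * n₁) = m := by rw [mul_comm, hα]
  have hc : IsCoprime (n₁ : ℤ) n₂ := Nat.isCoprime_iff_coprime.2 hcop
  obtain ⟨d, hd, hdO⟩ := exists_coprime_smul_mem_adjoinInt hm hu (Nat.mul_pos h1 h2) hα
  obtain ⟨R₁, hA₁, hO₁, hi₁, ht₁, hs₁⟩ := exists_intermediate_addSubgroup hm hu h1 h2 hα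
  obtain ⟨R₂, hA₂, hO₂, hi₂, ht₂, hs₂⟩ := exists_intermediate_addSubgroup hm hu h2 h1 hα'
  have hinf : R₁ ⊓ R₂ = adjoinInt α := le_antisymm
    (fun z hz => AddSubgroup.mem_of_isCoprime_zsmul_mem hc.pow (ht₁ z hz.1) (ht₂ z hz.2))
    (le_inf hA₁ hA₂)
  have hsup : R₁ ⊔ R₂ = integersOfAdjoin α := by
    refine le_antisymm (sup_le hO₁ hO₂) fun z hz => ?_
    -- Two coprimality steps: `d` against `m ^ (n₁ + n₂)`, then `n₁ ^ n₁` against `n₂ ^ n₂`.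
    refine AddSubgroup.mem_of_isCoprime_zsmul_mem (hd.pow_right (n := n₁ + n₂))
      (le_sup_of_le_left hA₁ (hdO z hz)) ?_
    refine AddSubgroup.mem_of_isCoprime_zsmul_mem (hc.pow (m := n₁) (n := n₂)) ?_ ?_
    -- `n₁ ^ n₁ * m ^ (n₁ + n₂) = m ^ n₂ * (n₁ * m) ^ n₁` sends `z` into `R₂`.
    · have := AddSubgroup.zsmul_mem _ (AddSubgroup.mem_sup_right (S := R₁) (hs₂ z hz)) (m ^ n₂)
      rw [smul_smul] at this
      rw [smul_smul]
      convert this using 2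
      ring
    · have := AddSubgroup.zsmul_mem _ (AddSubgroup.mem_sup_left (T := R₂) (hs₁ z hz)) (m ^ n₁)
      rw [smul_smul] at this
      rw [smul_smul]
      convert this using 2
      ring
  -- `(O : A) = (R₁ : A) (R₁ + R₂ : R₁)`, and the last index equals `(R₂ : R₁ ∩ R₂) = (R₂ : A)`.
  rw [← ringIndex_eq_of_pow_eq hm hu h1 (by rw [← pow_mul, hα'] : (α ^ n₂) ^ n₁ = m) hα₁,
    ← ringIndex_eq_of_pow_eq hm hu h2 (by rw [← pow_mul, hα] : (α ^ n₁) ^ n₂ = m) hα₂,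
    ← hi₁, ← hi₂, ← relIndex_adjoinInt_integersOfAdjoin,
    ← AddSubgroup.relIndex_mul_relIndex _ _ _ hA₁ hO₁, ← hsup, sup_comm R₁ R₂,
    AddSubgroup.relIndex_sup_right, ← AddSubgroup.inf_relIndex_right R₁ R₂, hinf]
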